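/- Let $(\Omega,\mathcal A,P)$ be a complete probability space, let $\mathcal H\subseteq\mathcal F\subseteq\mathcal A$ be complete sub-$\sigma$-algebras, and let $y\in L^0(\mathbb R^d,\mathcal H)$ and $Y\in L^0(\mathbb R^d,\mathcal F)$ be non-negative (coordinatewise). Let $\mathrm{supp}_{\mathcal H}Y(\omega)$ denote the conditional support of $Y$, i.e. the intersection of all closed sets $A\subseteq\mathbb R^d$ with $\mu(A,\omega)=1$, where $\mu$ is a regular version of the conditional law of $Y$ knowing $\mathcal H$. Let $g:\Omega\times\mathbb R^d\to\mathbb R$ be an $\mathcal H$-normal integrand, i.e. $\omega\mapsto\{(x,r)\in\mathbb R^d\times\mathbb R:\ g(\omega,x)\le r\}$ is a closed-valued $\mathcal H$-measurable set-valued map. The set of super-hedging prices of $g(Y)$ is $$\mathcal P(g)=\{x\in L^0(\mathbb R,\mathcal H):\ \exists\,\theta\in L^0(\mathbb R^d,\mathcal H),\ x+\theta\cdot(Y-y)\ge g(Y)\ \text{a.s.}\},$$ and $p(g)$ is its $\mathcal H$-conditional essential infimum, i.e. the a.s. greatest $\mathcal H$-measurable $[-\infty,\infty]$-valued random variable that is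 a.s. $\le x$ for every $x\in\mathcal P(g)$. For $S\subseteq\mathbb R^d$ and $h:\mathbb R^d\to\mathbb R$, let $$\mathrm{conc}(h,S)(x)=\inf\{v(x):\ v:\mathbb R^d\to[-\infty,\infty]\ \text{concave},\ v(z)\ge h(z)\ \forall z\in S\}$$ be the relative concave envelope (an extended-real-valued function is called concave if its hypograph is convex), let $\overline{\mathrm{conc}}(h,S)(x)=\limsup_{z\to x}\mathrm{conc}(h,S)(z)$ be its upper closure ($z=x$ being allowed in the limsup), and let $\delta_C(x)=0$ if $x\in C$ and $\delta_C(x)=+\infty$ otherwise. Let $\overline{\mathrm{conv}}\,S$ be the closed convex hull of $S$ (it equals $\mathrm{conv}\,S$ whenever the latter is closed, e.g. for $S$ closed and $d=1$, or for $S$ compact). Suppose that for almost every $\omega$ there is a concave function $\varphi=\varphi(\omega,\cdot):\mathbb R^d\to[-\infty,\infty]$ with $g(\omega,\cdot)\le\varphi$ on $\mathrm{supp}_{\mathcal H}Y(\omega)$ and $\varphi<\infty$ on $\mathrm{conv}\,\mathrm{supp}_{\mathcal H}Y(\omega)$. Then, a.s., $$p(g)=\overline{\mathrm{conc}}(g,\mathrm{supp}_{\mathcal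 H}Y)(y)-\delta_{\overline{\mathrm{conv}}\,\mathrm{supp}_{\mathcal H}Y}(y)$$ and $$p(g)=\inf\{\alpha\cdot y+\beta:\ \alpha\in\mathbb R^d,\ \beta\in\mathbb R,\ \alpha\cdot z+\beta\ge g(z)\ \forall z\in\mathrm{supp}_{\mathcal H}Y\}-\delta_{\overline{\mathrm{conv}}\,\mathrm{supp}_{\mathcal H}Y}(y).$$ In particular $p(g)=-\infty$ a.s. on the event $y\notin\overline{\mathrm{conv}}\,\mathrm{supp}_{\mathcal H}Y$. -/

import Mathlib

open MeasureTheory ProbabilityTheory Filter Topology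
open scoped ENNReal

noncomputable section

/-! ### Normal integrands -/

/-- The epigraph of `f : ℝᵈ → ℝ`, a subset of `ℝᵈ × ℝ`. -/
def epigraphSet {d : ℕ} (f : EuclideanSpace ℝ (Fin d) → ℝ) :
    Set (EuclideanSpace ℝ (Fin d) × ℝ) :=
  {p | f p.1 ≤ p.2}

/-- `g : Ω × ℝᵈ → ℝ` is an `H`-normal integrand: the epigraphical mapping
`ω ↦ epi g(ω, ·)` is closed-valued and `H`-measurable as a set-valued map. -/
structure IsNormalIntegrand {Ω : Type*} (H : MeasurableSpace Ω) {d : ℕ}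
    (g : Ω → EuclideanSpace ℝ (Fin d) → ℝ) : Prop where
  isClosed_epi : ∀ ω, IsClosed (epigraphSet (g ω))
  measurable_epi : ∀ O : Set (EuclideanSpace ℝ (Fin d) × ℝ), IsOpen O →
    MeasurableSet[H] {ω | (epigraphSet (g ω) ∩ O).Nonempty}

/-! ### Conditional law and conditional support -/

/-- The `H`-measurable probability kernel `κ` is a regular version of the conditional law of `Y`
knowing `H`. -/
structure IsRegularCondLaw {Ω : Type*} (H : MeasurableSpace Ω)
    [mΩ : MeasurableSpace Ω] (P : Measure Ω) {d : ℕ} (Y : Ω → EuclideanSpace ℝ (Fin d))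
    (κ : Kernel[H] Ω (EuclideanSpace ℝ (Fin d))) : Prop where
  isProbabilityMeasure : ∀ ω, IsProbabilityMeasure (κ ω)
  ae_eq_condExp : ∀ A : Set (EuclideanSpace ℝ (Fin d)), MeasurableSet A →
    (fun ω => (κ ω).real A) =ᵐ[P] P⟦Y ⁻¹' A | H⟧

/-- The support of the kernel `κ` at `ω`. For `κ` the conditional law of `Y` knowing `H` this is the
conditional support of `Y` with respect to `H`. -/
def kernelSupport {Ω : Type*} {H : MeasurableSpace Ω} {d : ℕ}
    (κ : Kernel[H] Ω (EuclideanSpace ℝ (Fin d))) (ω : Ω) : Set (EuclideanSpace ℝ (Fin d)) :=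
  (κ ω).support

/-- The support is the intersection of all closed sets of full mass. -/
theorem kernelSupport_eq_sInter {Ω : Type*} {H : MeasurableSpace Ω} {d : ℕ}
    (κ : Kernel[H] Ω (EuclideanSpace ℝ (Fin d))) (ω : Ω) (h : IsProbabilityMeasure (κ ω)) :
    kernelSupport κ ω = ⋂₀ {A | IsClosed A ∧ κ ω A = 1} := by
  rw [kernelSupport, Measure.support_eq_sInter]
  congr 1
  ext A
  simp only [Set.mem_ofPred_eq]
  exact and_congr_right fun hA => prob_compl_eq_zero_iff hA.measurableSet

/-! ### Conditional essential infimum -/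

/-- `γ` is an `H`-conditional essential infimum of the family `Γ` of real random variables: the
a.s. greatest `H`-measurable extended random variable lying a.s. below each element of `Γ`. -/
structure IsCondEssInf {Ω : Type*} (H : MeasurableSpace Ω)
    [mΩ : MeasurableSpace Ω] (P : Measure Ω) (Γ : Set (Ω → ℝ)) (γ : Ω → EReal) : Prop where
  measurable : Measurable[H] γ
  le : ∀ x ∈ Γ, ∀ᵐ ω ∂P, γ ω ≤ (x ω : EReal)
  greatest : ∀ ζ : Ω → EReal, Measurable[H] ζ →
    (∀ x ∈ Γ, ∀ᵐ ω ∂P, ζ ω ≤ (x ω : EReal)) → ∀ᵐ ω ∂P, ζ ω ≤ γ ω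

theorem exists_isCondEssInf {Ω : Type*} {H : MeasurableSpace Ω} [mΩ : MeasurableSpace Ω]
    (P : Measure Ω) [IsProbabilityMeasure P] (hH : H ≤ mΩ) (Γ : Set (Ω → ℝ)) :
    ∃ γ : Ω → EReal, IsCondEssInf H P Γ γ := by
  let Z : Set (Ω → EReal) :=
    {ζ | Measurable[H] ζ ∧ ∀ x ∈ Γ, ∀ᵐ ω ∂P, ζ ω ≤ (x ω : EReal)}
  have hbot : (fun _ => ⊥ : Ω → EReal) ∈ Z :=
    ⟨measurable_const, fun x _ => Eventually.of_forall fun ω => bot_le⟩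
  let J : ℚ → (Ω → EReal) → ℝ≥0∞ := fun q ζ => P {ω | ((q : ℝ) : EReal) < ζ ω}
  have hseq : ∀ q : ℚ, ∃ u : ℕ → Ω → EReal, (∀ n, u n ∈ Z) ∧
      Tendsto (fun n => J q (u n)) atTop (𝓝 (sSup (J q '' Z))) := by
    intro q
    obtain ⟨v, -, hv, hvZ⟩ :=
      exists_seq_tendsto_sSup (S := J q '' Z) ⟨_, _, hbot, rfl⟩ (OrderTop.bddAbove _)
    choose u hu huv using hvZ
    exact ⟨u, hu, by simpa only [huv] using hv⟩
  choose u huZ hu using hseq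
  let γ : Ω → EReal := fun ω => ⨆ q, ⨆ n, u q n ω
  have hγm : Measurable[H] γ :=
    Measurable.iSup fun q => Measurable.iSup fun n => (huZ q n).1
  have hγle : ∀ x ∈ Γ, ∀ᵐ ω ∂P, γ ω ≤ (x ω : EReal) := by
    intro x hx
    have : ∀ᵐ ω ∂P, ∀ q n, u q n ω ≤ (x ω : EReal) :=
      ae_all_iff.2 fun q => ae_all_iff.2 fun n => (huZ q n).2 x hx
    filter_upwards [this] with ω hω
    exact iSup_le fun q => iSup_le fun n => hω q n
  refine ⟨γ, hγm, hγle, fun ζ hζm hζ => ?_⟩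
  have key : ∀ q : ℚ, P ({ω | ((q : ℝ) : EReal) < ζ ω} \ {ω | ((q : ℝ) : EReal) < γ ω}) = 0 := by
    intro q
    have hmax : (fun ω => ζ ω ⊔ γ ω) ∈ Z := by
      refine ⟨hζm.sup hγm, fun x hx => ?_⟩
      filter_upwards [hζ x hx, hγle x hx] with ω h1 h2 using sup_le h1 h2
    have h1 : J q (fun ω => ζ ω ⊔ γ ω) ≤ sSup (J q '' Z) := le_sSup ⟨_, hmax, rfl⟩
    have h2 : sSup (J q '' Z) ≤ J q γ := by
      refine le_of_tendsto (hu q) (Eventually.of_forall fun n => measure_mono fun ω hω => ?_)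
      have h3 : u q n ω ≤ γ ω :=
        (le_iSup (fun n => u q n ω) n).trans (le_iSup (fun q => ⨆ n, u q n ω) q)
      exact lt_of_lt_of_le hω h3
    have hmγ : MeasurableSet {ω | ((q : ℝ) : EReal) < γ ω} := hH _ (hγm measurableSet_Ioi)
    have hsub : {ω | ((q : ℝ) : EReal) < γ ω} ⊆ {ω | ((q : ℝ) : EReal) < ζ ω ⊔ γ ω} :=
      fun ω (hω : ((q : ℝ) : EReal) < γ ω) =>
        show ((q : ℝ) : EReal) < ζ ω ⊔ γ ω from lt_of_lt_of_le hω le_sup_right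
    have hsub' : {ω | ((q : ℝ) : EReal) < ζ ω} ⊆ {ω | ((q : ℝ) : EReal) < ζ ω ⊔ γ ω} :=
      fun ω (hω : ((q : ℝ) : EReal) < ζ ω) =>
        show ((q : ℝ) : EReal) < ζ ω ⊔ γ ω from lt_of_lt_of_le hω le_sup_left
    have h3 : P ({ω | ((q : ℝ) : EReal) < ζ ω ⊔ γ ω} \ {ω | ((q : ℝ) : EReal) < γ ω}) = 0 := by
      rw [measure_sdiff hsub hmγ.nullMeasurableSet (measure_ne_top _ _)]
      exact tsub_eq_zero_of_le (h1.trans h2)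
    exact measure_mono_null (Set.sdiff_subset_sdiff_left hsub') h3
  have hall : ∀ᵐ ω ∂P, ∀ q : ℚ, ((q : ℝ) : EReal) < ζ ω → ((q : ℝ) : EReal) < γ ω := by
    refine ae_all_iff.2 fun q => ?_
    rw [ae_iff]
    refine measure_mono_null (fun ω hω => ?_) (key q)
    simpa [Classical.not_imp] using hω
  filter_upwards [hall] with ω hω
  by_contra hlt
  obtain ⟨q, hq1, hq2⟩ := EReal.lt_iff_exists_rat_btwn.1 (not_le.1 hlt)
  exact lt_asymm hq1 (hω q hq2)

/-- The `H`-conditional essential infimum of a family of real random variables. -/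
def condEssInf {Ω : Type*} {H : MeasurableSpace Ω} [mΩ : MeasurableSpace Ω]
    (P : Measure Ω) [IsProbabilityMeasure P] (hH : H ≤ mΩ) (Γ : Set (Ω → ℝ)) : Ω → EReal :=
  Classical.choose (exists_isCondEssInf P hH Γ)

theorem isCondEssInf_condEssInf {Ω : Type*} {H : MeasurableSpace Ω} [mΩ : MeasurableSpace Ω]
    (P : Measure Ω) [IsProbabilityMeasure P] (hH : H ≤ mΩ) (Γ : Set (Ω → ℝ)) :
    IsCondEssInf H P Γ (condEssInf P hH Γ) :=
  Classical.choose_spec (exists_isCondEssInf P hH Γ)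

/-! ### Super-hedging prices -/

/-- The set of super-hedging prices of `g(Y)`: the initial values `x ∈ L⁰(ℝ, H)` for which some
strategy `θ ∈ L⁰(ℝᵈ, H)` satisfies `x + θ (Y - y) ≥ g(Y)` a.s. -/
def superhedgingPrices {Ω : Type*} (H : MeasurableSpace Ω)
    [mΩ : MeasurableSpace Ω] (P : Measure Ω) {d : ℕ} (y Y : Ω → EuclideanSpace ℝ (Fin d))
    (g : Ω → EuclideanSpace ℝ (Fin d) → ℝ) : Set (Ω → ℝ) :=
  {x | Measurable[H] x ∧ ∃ θ : Ω → EuclideanSpace ℝ (Fin d), Measurable[H] θ ∧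
    ∀ᵐ ω ∂P, g ω (Y ω) ≤ x ω + inner ℝ (θ ω) (Y ω - y ω)}

/-- The infimum super-hedging cost `p(g)`. -/
def superhedgingCost {Ω : Type*} {H : MeasurableSpace Ω} [mΩ : MeasurableSpace Ω]
    (P : Measure Ω) [IsProbabilityMeasure P] (hH : H ≤ mΩ) {d : ℕ}
    (y Y : Ω → EuclideanSpace ℝ (Fin d)) (g : Ω → EuclideanSpace ℝ (Fin d) → ℝ) : Ω → EReal :=
  condEssInf P hH (superhedgingPrices H P y Y g)

/-! ### Concave envelopes -/

/-- An extended-real-valued function on `ℝᵈ` is concave if its hypograph is convex. -/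
def IsConcaveEReal {d : ℕ} (v : EuclideanSpace ℝ (Fin d) → EReal) : Prop :=
  Convex ℝ {p : EuclideanSpace ℝ (Fin d) × ℝ | (p.2 : EReal) ≤ v p.1}

/-- The relative concave envelope `conc(g, S)`: the pointwise infimum of all concave functions
dominating `g` on `S`. -/
def relConc {d : ℕ} (g : EuclideanSpace ℝ (Fin d) → ℝ) (S : Set (EuclideanSpace ℝ (Fin d)))
    (x : EuclideanSpace ℝ (Fin d)) : EReal :=
  sInf {r | ∃ v : EuclideanSpace ℝ (Fin d) → EReal,
    IsConcaveEReal v ∧ (∀ z ∈ S, (g z : EReal) ≤ v z) ∧ r = v x}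

/-- The upper closure of `h`, `x ↦ limsup_{z → x} h z` (where `z = x` is allowed). -/
def uscClosure {d : ℕ} (h : EuclideanSpace ℝ (Fin d) → EReal)
    (x : EuclideanSpace ℝ (Fin d)) : EReal :=
  limsup h (𝓝 x)

/-- The infimum of the values at `x` of the affine functions dominating `g` on `S`. -/
def affineEnvelope {d : ℕ} (g : EuclideanSpace ℝ (Fin d) → ℝ)
    (S : Set (EuclideanSpace ℝ (Fin d))) (x : EuclideanSpace ℝ (Fin d)) : EReal :=
  sInf {r | ∃ (α : EuclideanSpace ℝ (Fin d)) (β : ℝ),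
    (∀ z ∈ S, g z ≤ inner ℝ α z + β) ∧ r = ((inner ℝ α x + β : ℝ) : EReal)}

open scoped Classical in
/-- The convex-analysis indicator `δ_C`: `0` on `C` and `+∞` elsewhere. -/
def deltaInd {d : ℕ} (C : Set (EuclideanSpace ℝ (Fin d))) (x : EuclideanSpace ℝ (Fin d)) : EReal :=
  if x ∈ C then 0 else ⊤

end

/-!
The argument reduces super-hedging to the pointwise domination of the payoff by affine functions on
the conditional support, and then to a countable infimum.

A pair `(x, θ)` super-hedges `g(Y)` almost surely iff, for almost every `ω`, the affine function
`z ↦ x + ⟪θ, z - y⟫` dominates `g(ω, ·)` on the conditional support (`ae_le_add_inner_iff`): by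
disintegration the set of violations has zero conditional mass, and since `g(ω, ·)` is lower
semicontinuous this set is open, so it misses the support. Hence every price is at least the affine
envelope at `y`.

For the converse, the least constant `supDeviation` that goes with a given slope is decreasing in the
slope, coordinate by coordinate, because the support lies in the non-negative orthant. The affine
envelope is therefore an infimum over rational slopes (`affineEnvelope_eq_iInf_ratVector`), which
makes it `H`-measurable, and each rational slope gives an actual price, after
replacement by another rational slope on the event where it admits no constant
(`exists_superhedge_eq_supDeviation`). So the cost equals the affine envelope at `y`
(`superhedgingCost_ae_eq_affineEnvelope`).

The rest is convex analysis for a fixed `ω`. A concave majorant that is finite on the convex hull of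
the support yields an affine majorant (`exists_affine_majorant_of_isConcaveEReal`). Once there is one,
separating points from the convex hull of the hypograph of `g` shows that the upper closure of the
concave envelope is the affine envelope (`uscClosure_relConc_eq_affineEnvelope`), and tilting the
majorant along a hyperplane shows that the latter is `⊥` off the closed convex hull, so that the
indicator term changes nothing (`affineEnvelope_sub_deltaInd`).
-/

/-! ### Separation of hypographs in `E × ℝ` and affine majorants of concave functions -/

section ConvexAnalysis

variable {E : Type*} [NormedAddCommGroup E] [InnerProductSpace ℝ E]

/-- Strict separation of a point from a convex subset of `E × ℝ`, with the functional split into its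
horizontal part `a` and its slope `b` in the vertical direction. -/
theorem exists_inner_add_mul_separation [CompleteSpace E] {K : Set (E × ℝ)} (hK : Convex ℝ K)
    {x : E} {t : ℝ} (h : (x, t) ∉ closure K) :
    ∃ (a : E) (b c : ℝ), (∀ p ∈ K, inner ℝ a p.1 + b * p.2 < c) ∧ c < inner ℝ a x + b * t := by
  obtain ⟨f, c, hf, hc⟩ := geometric_hahn_banach_closed_point hK.closure isClosed_closure h
  let f₁ : StrongDual ℝ E := f.comp (ContinuousLinearMap.inl ℝ E ℝ)
  have key : ∀ p : E × ℝ,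
      inner ℝ ((InnerProductSpace.toDual ℝ E).symm f₁) p.1 + f (0, 1) * p.2 = f p := by
    intro p
    rw [InnerProductSpace.toDual_symm_apply]
    have hp : p = ContinuousLinearMap.inl ℝ E ℝ p.1 + p.2 • ((0, 1) : E × ℝ) := by
      ext <;> simp
    conv_rhs => rw [hp, map_add, map_smul]
    simp [f₁, mul_comm]
  exact ⟨_, _, c, fun p hp => by rw [key]; exact hf p (subset_closure hp), by
    have := key (x, t)
    dsimp only at this
    rw [this]; exact hc⟩

/-- A real concave function on a convex set has an affine majorant. Near a point `y` of the relative
interior of a simplex in `C` that spans the affine hull of `C` the function is bounded above, by reflecting through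
`y`, so some point above `y` can be separated from the hypograph. -/
theorem ConcaveOn.exists_inner_add_const_le [FiniteDimensional ℝ E] {C : Set E} {f : E → ℝ}
    (hf : ConcaveOn ℝ C f) (hC : C.Nonempty) :
    ∃ (a : E) (b : ℝ), ∀ z ∈ C, f z ≤ inner ℝ a z + b := by
  have : CompleteSpace E := FiniteDimensional.complete ℝ E
  obtain ⟨t, htC, hspan, hind⟩ := exists_affineIndependent ℝ E C
  have htfin : t.Finite := finite_set_of_fin_dim_affineIndependent ℝ hind
  have htne : t.Nonempty := by
    rw [← affineSpan_nonempty ℝ, hspan, affineSpan_nonempty]; exact hC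
  have hhull : convexHull ℝ t ⊆ C := convexHull_min htC hf.1
  -- `f` is bounded below by its least value `m` at the vertices of the simplex spanned by `t`
  obtain ⟨m, hm⟩ : ∃ m, ∀ z ∈ convexHull ℝ t, m ≤ f z := by
    obtain ⟨m, hm⟩ := (htfin.image f).bddBelow
    refine ⟨m, fun z hz => ?_⟩
    obtain ⟨w, hw, hwz⟩ := hf.exists_le_of_mem_convexHull htC hz
    exact (hm ⟨w, hw, rfl⟩).trans hwz
  obtain ⟨x₀, hx₀⟩ :=
    ((convexHull_nonempty_iff (𝕜 := ℝ)).2 htne).intrinsicInterior (convex_convexHull ℝ t)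
  obtain ⟨y, hy, rfl⟩ := mem_intrinsicInterior.1 hx₀
  obtain ⟨ε, hε, hball⟩ := Metric.mem_nhds_iff.1 (mem_interior_iff_mem_nhds.1 hy)
  have hspan' : affineSpan ℝ (convexHull ℝ t) = affineSpan ℝ C := by
    rw [affineSpan_convexHull, hspan]
  have hy_span : (y : E) ∈ affineSpan ℝ C := hspan'.le y.2
  have hyC : (y : E) ∈ C := hhull (intrinsicInterior_subset hx₀)
  -- reflecting a point of `C` near `y` through `y` gives a point of the simplex
  have hbound : ∀ z ∈ C, dist z y < ε → f z ≤ 2 * f y - m := by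
    intro z hz hzy
    have hwspan : (2 : ℝ) • (y : E) - z ∈ affineSpan ℝ (convexHull ℝ t) := by
      have hweq : AffineMap.lineMap z (y : E) (2 : ℝ) = (2 : ℝ) • (y : E) - z := by
        rw [AffineMap.lineMap_apply_module]; module
      rw [← hweq]
      exact hspan'.ge (AffineMap.lineMap_mem _ (subset_affineSpan ℝ C hz) hy_span)
    have hw : (2 : ℝ) • (y : E) - z ∈ convexHull ℝ t := by
      refine hball (a := ⟨_, hwspan⟩) ?_
      rw [Metric.mem_ball, Subtype.dist_eq, dist_eq_norm]
      rw [dist_comm, dist_eq_norm] at hzy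
      convert hzy using 2
      module
    have h1 := hf.2 hz (hhull hw) (by norm_num : (0 : ℝ) ≤ 1 / 2) (by norm_num : (0 : ℝ) ≤ 1 / 2)
      (by norm_num)
    have h2 : (1 / 2 : ℝ) • z + (1 / 2 : ℝ) • ((2 : ℝ) • (y : E) - z) = y := by module
    rw [h2] at h1
    have h3 := hm _ hw
    simp only [smul_eq_mul] at h1
    linarith
  have hnot : ((y : E), 2 * f y - m + 1) ∉ closure {p : E × ℝ | p.1 ∈ C ∧ p.2 ≤ f p.1} := by
    intro hmem
    obtain ⟨p, ⟨hp1, hp2⟩, hp3⟩ := Metric.mem_closure_iff.1 hmem (min ε 1) (by positivity)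
    rw [Prod.dist_eq, max_lt_iff] at hp3
    have h1 := hbound p.1 hp1 (by rw [dist_comm]; exact hp3.1.trans_le (min_le_left _ _))
    have h2 := (abs_lt.1 (hp3.2.trans_le (min_le_right _ _))).2
    dsimp only at h2
    linarith
  obtain ⟨a, b, c, hK, hc⟩ := exists_inner_add_mul_separation hf.convex_hypograph hnot
  have h0 := hK (y, f y) ⟨hyC, le_rfl⟩
  have hmy := hm y (intrinsicInterior_subset hx₀)
  dsimp only at h0
  -- the separating hyperplane is not vertical, since `y` itself lies in `C`
  have hb : 0 < b := by
    have : 0 < b * (f y - m + 1) := by linarith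
    exact pos_of_mul_pos_left this (by linarith)
  refine ⟨-b⁻¹ • a, b⁻¹ * c, fun z hz => ?_⟩
  have h1 := hK (z, f z) ⟨hz, le_rfl⟩
  dsimp only at h1
  rw [inner_smul_left, starRingEnd_apply, star_trivial]
  have : f z = b⁻¹ * (b * f z) := by field_simp
  rw [this]
  have := mul_le_mul_of_nonneg_left (show b * f z ≤ c - inner ℝ a z by linarith)
    (inv_nonneg.2 hb.le)
  linarith

end ConvexAnalysis

/-! ### The affine envelope and the upper closure of the concave envelope -/

section Envelopes

variable {d : ℕ} {g : EuclideanSpace ℝ (Fin d) → ℝ} {S : Set (EuclideanSpace ℝ (Fin d))}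

/-- A concave majorant of `g` on `S` that stays below `⊤` on the convex hull of `S` is real-valued
there, since it is above `⊥` at the points of `S`; hence it provides an affine majorant. -/
theorem exists_affine_majorant_of_isConcaveEReal {φ : EuclideanSpace ℝ (Fin d) → EReal}
    (hφ : IsConcaveEReal φ) (hS : S.Nonempty) (hgφ : ∀ z ∈ S, (g z : EReal) ≤ φ z)
    (htop : ∀ z ∈ convexHull ℝ S, φ z < ⊤) :
    ∃ (α : EuclideanSpace ℝ (Fin d)) (β : ℝ), ∀ z ∈ S, g z ≤ inner ℝ α z + β := by
  have hdom : convexHull ℝ S ⊆ {z | ∃ r : ℝ, (r : EReal) ≤ φ z} := by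
    refine convexHull_min (fun z hz => ⟨g z, hgφ z hz⟩) ?_
    have : {z | ∃ r : ℝ, (r : EReal) ≤ φ z} = LinearMap.fst ℝ (EuclideanSpace ℝ (Fin d)) ℝ ''
        {p : EuclideanSpace ℝ (Fin d) × ℝ | (p.2 : EReal) ≤ φ p.1} := by
      ext z; simp
    rw [this]
    exact Convex.linear_image hφ _
  have hreal : ∀ z ∈ convexHull ℝ S, ((φ z).toReal : EReal) = φ z := by
    intro z hz
    obtain ⟨r, hr⟩ := hdom hz
    exact EReal.coe_toReal (htop z hz).ne (ne_bot_of_le_ne_bot (EReal.coe_ne_bot r) hr)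
  have hconc : ConcaveOn ℝ (convexHull ℝ S) fun z => (φ z).toReal := by
    refine ⟨convex_convexHull ℝ S, fun z hz w hw a b ha hb hab => ?_⟩
    have := hφ (x := (z, (φ z).toReal)) (hreal z hz).le (y := (w, (φ w).toReal)) (hreal w hw).le
      ha hb hab
    have h2 : ((a • (φ z).toReal + b • (φ w).toReal : ℝ) : EReal) ≤ φ (a • z + b • w) := this
    rw [← hreal _ (convex_convexHull ℝ S hz hw ha hb hab)] at h2
    exact EReal.coe_le_coe_iff.1 h2
  obtain ⟨a, b, hab⟩ := hconc.exists_inner_add_const_le (convexHull_nonempty_iff.2 hS)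
  refine ⟨a, b, fun z hz => le_trans ?_ (hab z (subset_convexHull ℝ S hz))⟩
  rw [← EReal.coe_le_coe_iff, hreal z (subset_convexHull ℝ S hz)]
  exact hgφ z hz

theorem affineEnvelope_le {α : EuclideanSpace ℝ (Fin d)} {β : ℝ}
    (h : ∀ z ∈ S, g z ≤ inner ℝ α z + β) (x : EuclideanSpace ℝ (Fin d)) :
    affineEnvelope g S x ≤ ((inner ℝ α x + β : ℝ) : EReal) :=
  sInf_le ⟨α, β, h, rfl⟩

/-- If a hyperplane strictly separates `x` from `S`, tilting an affine majorant along it sends its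
value at `x` to `⊥`. -/
theorem affineEnvelope_eq_bot_of_separated {α : EuclideanSpace ℝ (Fin d)} {β : ℝ}
    (h : ∀ z ∈ S, g z ≤ inner ℝ α z + β) {x a : EuclideanSpace ℝ (Fin d)} {c : ℝ}
    (haS : ∀ z ∈ S, inner ℝ a z < c) (hax : c < inner ℝ a x) :
    affineEnvelope g S x = ⊥ := by
  rw [EReal.eq_bot_iff_forall_lt]
  intro r
  -- adding a large multiple of `c - ⟪a, ·⟫ ≥ 0` to the majorant pushes its value at `x` below `r`
  let s : ℝ := (|inner ℝ α x + β - r| + 1) / (inner ℝ a x - c)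
  have hpos : 0 < inner ℝ a x - c := by linarith
  have hs : 0 ≤ s := by positivity
  have hsx : s * (inner ℝ a x - c) = |inner ℝ α x + β - r| + 1 := by
    simp only [s]; field_simp
  refine (affineEnvelope_le (α := α - s • a) (β := β + s * c) (fun z hz => ?_) x).trans_lt ?_
  · rw [inner_sub_left, inner_smul_left, starRingEnd_apply, star_trivial]
    have := mul_nonneg hs (sub_nonneg.2 (haS z hz).le)
    linarith [h z hz]
  · rw [EReal.coe_lt_coe_iff, inner_sub_left, inner_smul_left, starRingEnd_apply, star_trivial]
    linarith [le_abs_self (inner ℝ α x + β - r)]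

theorem affineEnvelope_eq_bot_of_notMem {α : EuclideanSpace ℝ (Fin d)} {β : ℝ}
    (h : ∀ z ∈ S, g z ≤ inner ℝ α z + β) {x : EuclideanSpace ℝ (Fin d)}
    (hx : x ∉ closedConvexHull ℝ S) : affineEnvelope g S x = ⊥ := by
  obtain ⟨f, c, hf, hc⟩ :=
    geometric_hahn_banach_closed_point convex_closedConvexHull isClosed_closedConvexHull hx
  refine affineEnvelope_eq_bot_of_separated h
    (a := (InnerProductSpace.toDual ℝ (EuclideanSpace ℝ (Fin d))).symm f) (c := c)
    (fun z hz => ?_) ?_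
  · rw [InnerProductSpace.toDual_symm_apply]
    exact hf z (subset_closedConvexHull hz)
  · rwa [InnerProductSpace.toDual_symm_apply]

/-- The indicator term is redundant: the affine envelope is already `⊥` off the closed convex hull. -/
theorem affineEnvelope_sub_deltaInd {α : EuclideanSpace ℝ (Fin d)} {β : ℝ}
    (h : ∀ z ∈ S, g z ≤ inner ℝ α z + β) (x : EuclideanSpace ℝ (Fin d)) :
    affineEnvelope g S x - deltaInd (closedConvexHull ℝ S) x = affineEnvelope g S x := by
  unfold deltaInd
  split_ifs with hx
  · simp
  · rw [affineEnvelope_eq_bot_of_notMem h hx, EReal.bot_sub]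

theorem isConcaveEReal_affine (α : EuclideanSpace ℝ (Fin d)) (β : ℝ) :
    IsConcaveEReal fun z => ((inner ℝ α z + β : ℝ) : EReal) := by
  intro p hp q hq a b ha hb hab
  simp only [Set.mem_ofPred_eq, EReal.coe_le_coe_iff] at hp hq ⊢
  simp only [Prod.fst_add, Prod.snd_add, Prod.smul_fst, Prod.smul_snd, inner_add_right,
    inner_smul_right, smul_eq_mul]
  have h1 := mul_le_mul_of_nonneg_left hp ha
  have h2 := mul_le_mul_of_nonneg_left hq hb
  have h3 : β = a * β + b * β := by rw [← add_mul, hab, one_mul]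
  linarith

/-- Every concave majorant contains the convex hull of the hypograph of `g` over `S` in its own
hypograph. -/
theorem le_relConc_of_mem_convexHull_hypograph {p : EuclideanSpace ℝ (Fin d) × ℝ}
    (hp : p ∈ convexHull ℝ {p : EuclideanSpace ℝ (Fin d) × ℝ | p.1 ∈ S ∧ p.2 ≤ g p.1}) :
    (p.2 : EReal) ≤ relConc g S p.1 := by
  refine le_sInf ?_
  rintro _ ⟨v, hv, hgv, rfl⟩
  refine convexHull_min (fun q hq => ?_) hv hp
  exact (EReal.coe_le_coe_iff.2 hq.2).trans (hgv q.1 hq.1)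

/-- The upper closure of the concave envelope is the infimum of the affine majorants. A point strictly
above the closed envelope is separated from the hypograph; a non-vertical hyperplane is an affine
majorant, and a vertical one makes the affine envelope `⊥`. -/
theorem uscClosure_relConc_eq_affineEnvelope {α : EuclideanSpace ℝ (Fin d)} {β : ℝ}
    (h : ∀ z ∈ S, g z ≤ inner ℝ α z + β) (hS : S.Nonempty) (x : EuclideanSpace ℝ (Fin d)) :
    uscClosure (relConc g S) x = affineEnvelope g S x := by
  refine le_antisymm (le_sInf ?_) (EReal.le_of_forall_lt_iff_le.1 fun r hr => ?_)
  · rintro _ ⟨a, b, hab, rfl⟩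
    have hle : ∀ z, relConc g S z ≤ ((inner ℝ a z + b : ℝ) : EReal) := fun z =>
      sInf_le ⟨_, isConcaveEReal_affine a b, fun w hw => EReal.coe_le_coe_iff.2 (hab w hw), rfl⟩
    have hcont : Continuous fun z : EuclideanSpace ℝ (Fin d) =>
        ((inner ℝ a z + b : ℝ) : EReal) := continuous_coe_real_ereal.comp (by fun_prop)
    exact (limsup_le_limsup (Eventually.of_forall hle)).trans (hcont.tendsto x).limsup_eq.le
  · have hev : ∀ᶠ z in 𝓝 x, relConc g S z < r := eventually_lt_of_limsup_lt hr
    obtain ⟨ε, hε, hball⟩ := Metric.eventually_nhds_iff.1 hev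
    set K := convexHull ℝ {p : EuclideanSpace ℝ (Fin d) × ℝ | p.1 ∈ S ∧ p.2 ≤ g p.1}
    have hnot : ∀ s > r, (x, s) ∉ closure K := by
      intro s hs hmem
      obtain ⟨p, hp, hdist⟩ := Metric.mem_closure_iff.1 hmem (min ε (s - r))
        (lt_min hε (sub_pos.2 hs))
      rw [Prod.dist_eq, max_lt_iff] at hdist
      have h1 := hball (y := p.1) (by rw [dist_comm]; exact hdist.1.trans_le (min_le_left _ _))
      have h2 := (abs_lt.1 (hdist.2.trans_le (min_le_right _ _))).2
      have h3 := EReal.coe_lt_coe_iff.1 ((le_relConc_of_mem_convexHull_hypograph hp).trans_lt h1)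
      dsimp only at h2
      linarith
    refine EReal.le_of_forall_lt_iff_le.1 fun s hs => ?_
    obtain ⟨a, b, c, hK, hc⟩ := exists_inner_add_mul_separation (convex_convexHull ℝ _)
      (hnot s (EReal.coe_lt_coe_iff.1 hs))
    have hKS : ∀ z ∈ S, ∀ u ≤ g z, inner ℝ a z + b * u < c := fun z hz u hu =>
      hK (z, u) (subset_convexHull ℝ _ ⟨hz, hu⟩)
    -- the hypograph is unbounded below, hence `0 ≤ b`
    have hb : 0 ≤ b := by
      by_contra! hb
      obtain ⟨z, hz⟩ := hS
      have h1 := hKS z hz (min (g z) ((c - inner ℝ a z) / b)) (min_le_left _ _)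
      have h2 := mul_le_mul_of_nonpos_left (min_le_right (g z) ((c - inner ℝ a z) / b)) hb.le
      rw [mul_div_cancel₀ _ hb.ne] at h2
      linarith
    rcases hb.eq_or_lt with rfl | hb
    · rw [affineEnvelope_eq_bot_of_separated h (a := a) (c := c)
        (fun z hz => by simpa using hKS z hz _ le_rfl) (by simpa using hc)]
      exact bot_le
    · refine (affineEnvelope_le (α := -b⁻¹ • a) (β := b⁻¹ * c) (fun z hz => ?_) x).trans ?_
      · rw [inner_smul_left, starRingEnd_apply, star_trivial]
        have := mul_le_mul_of_nonneg_left
          (show b * g z ≤ c - inner ℝ a z by linarith [hKS z hz _ le_rfl]) (inv_nonneg.2 hb.le)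
        rw [inv_mul_cancel_left₀ hb.ne'] at this
        linarith
      · rw [EReal.coe_le_coe_iff, inner_smul_left, starRingEnd_apply, star_trivial]
        have := mul_le_mul_of_nonneg_left
          (show c - inner ℝ a x ≤ b * s by linarith) (inv_nonneg.2 hb.le)
        rw [inv_mul_cancel_left₀ hb.ne'] at this
        linarith

end Envelopes

/-! ### The affine envelope as a countable infimum -/

section Conjugate

variable {d : ℕ}

/-- The supremum over `S` of `h z - ⟪α, z⟫`: the least constant `β` for which the affine function with
slope `α` and constant `β` dominates `h` on `S`, and `⊤` if there is none. Up to signs it is a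
Fenchel conjugate of `h` restricted to `S`. -/
noncomputable def supDeviation (h : EuclideanSpace ℝ (Fin d) → ℝ)
    (S : Set (EuclideanSpace ℝ (Fin d))) (α : EuclideanSpace ℝ (Fin d)) : EReal :=
  ⨆ z ∈ S, ((h z - inner ℝ α z : ℝ) : EReal)

variable {h : EuclideanSpace ℝ (Fin d) → ℝ} {S : Set (EuclideanSpace ℝ (Fin d))}

theorem supDeviation_le_coe_iff {α : EuclideanSpace ℝ (Fin d)} {β : ℝ} :
    supDeviation h S α ≤ β ↔ ∀ z ∈ S, h z ≤ inner ℝ α z + β := by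
  simp only [supDeviation, iSup₂_le_iff, EReal.coe_le_coe_iff, sub_le_iff_le_add, add_comm]

theorem bot_lt_supDeviation (hS : S.Nonempty) (α : EuclideanSpace ℝ (Fin d)) :
    ⊥ < supDeviation h S α := by
  obtain ⟨z, hz⟩ := hS
  exact (EReal.bot_lt_coe _).trans_le
    (le_iSup₂ (f := fun z (_ : z ∈ S) => ((h z - inner ℝ α z : ℝ) : EReal)) z hz)

theorem coe_toReal_supDeviation (hS : S.Nonempty) {α : EuclideanSpace ℝ (Fin d)}
    (hα : supDeviation h S α < ⊤) :
    ((supDeviation h S α).toReal : EReal) = supDeviation h S α :=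
  EReal.coe_toReal hα.ne (bot_lt_supDeviation hS α).ne'

theorem le_inner_add_toReal_supDeviation (hS : S.Nonempty) {α : EuclideanSpace ℝ (Fin d)}
    (hα : supDeviation h S α < ⊤) {z : EuclideanSpace ℝ (Fin d)} (hz : z ∈ S) :
    h z ≤ inner ℝ α z + (supDeviation h S α).toReal :=
  supDeviation_le_coe_iff.1 (coe_toReal_supDeviation hS hα).ge z hz

/-- On a subset of the non-negative orthant a larger slope needs a smaller constant. -/
theorem supDeviation_anti (hS0 : ∀ z ∈ S, ∀ i, 0 ≤ z i) {α α' : EuclideanSpace ℝ (Fin d)}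
    (hαα' : ∀ i, α i ≤ α' i) : supDeviation h S α' ≤ supDeviation h S α := by
  refine iSup₂_mono fun z hz => EReal.coe_le_coe_iff.2 (sub_le_sub_left ?_ _)
  simp only [PiLp.inner_apply, RCLike.inner_apply, conj_trivial]
  exact Finset.sum_le_sum fun i _ => mul_le_mul_of_nonneg_left (hαα' i) (hS0 z hz i)

/-- The vector of Euclidean space with the given rational coordinates. -/
noncomputable def ratVector (q : Fin d → ℚ) : EuclideanSpace ℝ (Fin d) :=
  WithLp.toLp 2 fun i => (q i : ℝ)

theorem exists_ratVector_ge_inner_lt (α x : EuclideanSpace ℝ (Fin d)) {r : ℝ}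
    (hr : inner ℝ α x < r) :
    ∃ q : Fin d → ℚ, (∀ i, α i ≤ ratVector q i) ∧ inner ℝ (ratVector q) x < r := by
  have hq : ∀ n : ℕ, ∀ i, ∃ q : ℚ, α i < q ∧ (q : ℝ) < α i + 1 / ((n : ℝ) + 1) := fun n i =>
    exists_rat_btwn (by have : (0 : ℝ) < 1 / ((n : ℝ) + 1) := by positivity
                        linarith)
  choose q hq1 hq2 using hq
  have hlim : Tendsto (fun n => inner ℝ (ratVector (q n)) x) atTop (𝓝 (inner ℝ α x)) := by
    simp only [PiLp.inner_apply, RCLike.inner_apply, conj_trivial, ratVector]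
    refine tendsto_finsetSum _ fun i _ => Tendsto.const_mul _ ?_
    refine tendsto_of_tendsto_of_tendsto_of_le_of_le tendsto_const_nhds ?_
      (fun n => (hq1 n i).le) (fun n => (hq2 n i).le)
    simpa using tendsto_const_nhds.add (tendsto_one_div_add_atTop_nhds_zero_nat (𝕜 := ℝ))
  obtain ⟨n, hn⟩ := (hlim.eventually_lt_const hr).exists
  exact ⟨q n, fun i => (hq1 n i).le, hn⟩

/-- Over a subset of the non-negative orthant, rational slopes suffice: rounding a slope up to a
rational one does not increase the constant it needs. This replaces a measurable selection of
slopes by a countable infimum. -/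
theorem affineEnvelope_eq_iInf_ratVector (hS : S.Nonempty) (hS0 : ∀ z ∈ S, ∀ i, 0 ≤ z i)
    (x : EuclideanSpace ℝ (Fin d)) :
    affineEnvelope h S x = ⨅ q : Fin d → ℚ,
      (supDeviation h S (ratVector q) + ((inner ℝ (ratVector q) x : ℝ) : EReal)) := by
  refine le_antisymm (le_iInf fun q => ?_) (le_sInf ?_)
  · rcases eq_or_ne (supDeviation h S (ratVector q)) ⊤ with htop | htop
    · simp [htop]
    · refine (affineEnvelope_le
        (fun z hz => le_inner_add_toReal_supDeviation hS htop.lt_top hz) x).trans ?_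
      rw [EReal.coe_add, coe_toReal_supDeviation hS htop.lt_top, add_comm]
  · rintro _ ⟨α, β, hαβ, rfl⟩
    refine EReal.le_of_forall_lt_iff_le.1 fun r hr => ?_
    rw [EReal.coe_lt_coe_iff] at hr
    obtain ⟨q, hq, hqr⟩ := exists_ratVector_ge_inner_lt α x (r := r - β) (by linarith)
    refine (iInf_le _ q).trans ((add_le_add_left
      ((supDeviation_anti hS0 hq).trans (supDeviation_le_coe_iff.2 hαβ)) _).trans ?_)
    rw [← EReal.coe_add, EReal.coe_le_coe_iff]
    linarith

theorem exists_ratVector_supDeviation_lt_top (hS0 : ∀ z ∈ S, ∀ i, 0 ≤ z i)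
    {α : EuclideanSpace ℝ (Fin d)} {β : ℝ} (hαβ : ∀ z ∈ S, h z ≤ inner ℝ α z + β) :
    ∃ q : Fin d → ℚ, supDeviation h S (ratVector q) < ⊤ := by
  obtain ⟨q, hq, -⟩ := exists_ratVector_ge_inner_lt α 0 (r := 1) (by simp)
  exact ⟨q, ((supDeviation_anti hS0 hq).trans (supDeviation_le_coe_iff.2 hαβ)).trans_lt
    (EReal.coe_lt_top β)⟩

end Conjugate

/-! ### Measurability of normal integrands and of the optimal constant -/

section Measurability

theorem IsNormalIntegrand.lowerSemicontinuous {Ω : Type*} {H : MeasurableSpace Ω} {d : ℕ}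
    {g : Ω → EuclideanSpace ℝ (Fin d) → ℝ} (hg : IsNormalIntegrand H g) (ω : Ω) :
    LowerSemicontinuous (g ω) :=
  lowerSemicontinuous_iff_isClosed_epigraph.2 (hg.isClosed_epi ω)

theorem IsNormalIntegrand.measurable_uncurry {Ω : Type*} {H : MeasurableSpace Ω} {d : ℕ}
    {g : Ω → EuclideanSpace ℝ (Fin d) → ℝ} (hg : IsNormalIntegrand H g) :
    Measurable (Function.uncurry g) := by
  obtain ⟨D, hDc, hDd⟩ := TopologicalSpace.exists_countable_dense (EuclideanSpace ℝ (Fin d))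
  refine measurable_of_Iic fun r => ?_
  let ε : ℕ → ℝ := fun n => 1 / ((n : ℝ) + 1)
  have hε : ∀ n, 0 < ε n := fun n => by positivity
  let A : ℕ → EuclideanSpace ℝ (Fin d) → Set Ω := fun n q =>
    {ω | (epigraphSet (g ω) ∩ (Metric.ball q (ε n) ×ˢ Set.Iio (r + ε n))).Nonempty}
  have hA : ∀ n q, MeasurableSet (A n q) := fun n q =>
    hg.measurable_epi _ (Metric.isOpen_ball.prod isOpen_Iio)
  -- by closedness of the epigraph, `g ω x ≤ r` iff points of the epigraph approach `(x, r)`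
  have key : Function.uncurry g ⁻¹' Set.Iic r =
      ⋂ n, ⋃ q ∈ D, A n q ×ˢ Metric.ball q (ε n) := by
    ext ⟨ω, x⟩
    simp only [Set.mem_preimage, Function.uncurry_apply_pair, Set.mem_Iic, Set.mem_iInter,
      Set.mem_iUnion, Set.mem_prod, exists_prop]
    constructor
    · intro hx n
      obtain ⟨q, hq, hqx⟩ := hDd.exists_dist_lt x (hε n)
      exact ⟨q, hq, ⟨(x, r), hx, Metric.mem_ball.2 hqx, by simpa using hε n⟩,
        Metric.mem_ball.2 hqx⟩
    · intro hx
      have hmem : (x, r) ∈ closure (epigraphSet (g ω)) := by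
        rw [Metric.mem_closure_iff]
        intro δ hδ
        obtain ⟨n, hn⟩ := exists_nat_one_div_lt (half_pos hδ)
        obtain ⟨q, -, ⟨⟨z, s⟩, hzs, hzq, hsr⟩, hxq⟩ := hx n
        refine ⟨(z, max s r), (show g ω z ≤ max s r from le_trans hzs (le_max_left _ _)), ?_⟩
        rw [Prod.dist_eq, max_lt_iff]
        constructor
        · have := dist_triangle_right x z q
          rw [Metric.mem_ball] at hxq hzq
          dsimp only at hzq ⊢
          change _ < ε n at hzq
          change ε n < δ / 2 at hn
          linarith
        · change s < r + ε n at hsr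
          change ε n < δ / 2 at hn
          dsimp only
          rw [dist_comm, Real.dist_eq, abs_of_nonneg (sub_nonneg.2 (le_max_right _ _)),
            sub_lt_iff_lt_add, max_lt_iff]
          constructor <;> linarith
      rw [(hg.isClosed_epi ω).closure_eq] at hmem
      exact hmem
  rw [key]
  exact MeasurableSet.iInter fun n => MeasurableSet.biUnion hDc fun q _ =>
    (hA n q).prod Metric.isOpen_ball.measurableSet

theorem MeasureTheory.Measure.nonempty_inter_support_iff_of_isOpen {X : Type*}
    [TopologicalSpace X] [SecondCountableTopology X] [MeasurableSpace X] {μ : Measure X}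
    {U : Set X} (hU : IsOpen U) : (U ∩ μ.support).Nonempty ↔ 0 < μ U := by
  refine ⟨?_, Measure.nonempty_inter_support_of_pos⟩
  rintro ⟨x, hxU, hx⟩
  exact Measure.mem_support_iff_forall x |>.1 hx U (hU.mem_nhds hxU)

/-- The sets `{z | c < g ω z - ⟪α, z⟫}` are open, so they meet the support exactly when `κ ω` charges
them, and their mass is measurable in `ω`. -/
theorem measurable_supDeviation_support {Ω : Type*} {H : MeasurableSpace Ω} {d : ℕ}
    {g : Ω → EuclideanSpace ℝ (Fin d) → ℝ} (hg : IsNormalIntegrand H g)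
    (κ : Kernel Ω (EuclideanSpace ℝ (Fin d))) [IsSFiniteKernel κ]
    (α : EuclideanSpace ℝ (Fin d)) :
    Measurable fun ω => supDeviation (g ω) (kernelSupport κ ω) α := by
  refine measurable_of_Ioi fun c => ?_
  let A : Set (Ω × EuclideanSpace ℝ (Fin d)) :=
    {p | c < ((Function.uncurry g p - inner ℝ α p.2 : ℝ) : EReal)}
  have hA : MeasurableSet A := measurableSet_lt measurable_const
    (measurable_coe_real_ereal.comp (hg.measurable_uncurry.sub (by fun_prop)))
  have hpre : (fun ω => supDeviation (g ω) (kernelSupport κ ω) α) ⁻¹' Set.Ioi c =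
      {ω | 0 < κ ω (Prod.mk ω ⁻¹' A)} := by
    ext ω
    have hopen : IsOpen (Prod.mk ω ⁻¹' A) := by
      have hlsc : LowerSemicontinuous fun z => g ω z - inner ℝ α z := by
        simp_rw [sub_eq_add_neg]
        exact (hg.lowerSemicontinuous ω).add
          (Continuous.lowerSemicontinuous (by fun_prop))
      exact (continuous_coe_real_ereal.comp_lowerSemicontinuous hlsc
        EReal.coe_strictMono.monotone).isOpen_preimage c
    simp only [Set.mem_preimage, Set.mem_Ioi, supDeviation, lt_iSup_iff, Set.mem_ofPred_eq,
      ← Measure.nonempty_inter_support_iff_of_isOpen hopen, kernelSupport]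
    exact ⟨fun ⟨z, hz, hc⟩ => ⟨z, hc, hz⟩, fun ⟨z, hc, hz⟩ => ⟨z, hz, hc⟩⟩
  rw [hpre]
  exact measurableSet_lt measurable_const (Kernel.measurable_kernel_prodMk_left hA)

end Measurability

/-! ### Disintegration of the joint law along the conditional law -/

section Disintegration

/-- If `κ` integrates measurable rectangles to the joint law of `(T, Y)`, it does so for every
measurable set. -/
theorem lintegral_kernel_prodMk_preimage {Ω Ω' E : Type*} [MeasurableSpace Ω]
    [MeasurableSpace Ω'] [MeasurableSpace E] {P : Measure Ω} [IsFiniteMeasure P] {T : Ω → Ω'}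
    (hT : Measurable T) {Y : Ω → E} (hY : Measurable Y) {κ : Kernel Ω' E} [IsFiniteKernel κ]
    (h : ∀ B A, MeasurableSet B → MeasurableSet A →
      ∫⁻ ω in T ⁻¹' B, κ (T ω) A ∂P = P (T ⁻¹' B ∩ Y ⁻¹' A))
    {B : Set (Ω' × E)} (hB : MeasurableSet B) :
    ∫⁻ ω, κ (T ω) (Prod.mk (T ω) ⁻¹' B) ∂P = P {ω | (T ω, Y ω) ∈ B} := by
  have hmap : P.map (fun ω => (T ω, Y ω)) = P.map T ⊗ₘ κ := by
    refine Measure.ext_prod fun {B A} hB hA => ?_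
    rw [Measure.map_apply (hT.prodMk hY) (hB.prod hA), Measure.compProd_apply_prod hB hA,
      setLIntegral_map hB (κ.measurable_coe hA) hT, h B A hB hA]
    rfl
  rw [← lintegral_map (Kernel.measurable_kernel_prodMk_left hB) hT, ← Measure.compProd_apply hB,
    ← hmap, Measure.map_apply (hT.prodMk hY) hB]
  rfl

/-- Almost surely `(ω, Y ω)` avoids `B` iff almost surely the conditional law of `Y` does not charge
the section of `B`. -/
theorem IsRegularCondLaw.ae_forall_notMem_iff {Ω : Type*} {H : MeasurableSpace Ω}
    [mΩ : MeasurableSpace Ω] {P : Measure Ω} [IsProbabilityMeasure P] (hH : H ≤ mΩ) {d : ℕ}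
    {Y : Ω → EuclideanSpace ℝ (Fin d)} (hY : Measurable Y)
    {κ : Kernel[H] Ω (EuclideanSpace ℝ (Fin d))} (hκ : IsRegularCondLaw H P Y κ)
    {B : Set (Ω × EuclideanSpace ℝ (Fin d))} (hB : MeasurableSet[H.prod inferInstance] B) :
    (∀ᵐ ω ∂P, (ω, Y ω) ∉ B) ↔ ∀ᵐ ω ∂P, κ ω (Prod.mk ω ⁻¹' B) = 0 := by
  have hmarkov : @IsMarkovKernel Ω _ H _ κ := @IsMarkovKernel.mk Ω _ H _ κ hκ.isProbabilityMeasure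
  have hT : @Measurable Ω Ω mΩ H id := measurable_id'' hH
  have hint := @lintegral_kernel_prodMk_preimage Ω Ω (EuclideanSpace ℝ (Fin d)) mΩ H _ P _ id hT
    Y hY κ inferInstance ?_ B hB
  · simp only [id] at hint
    have hmeas : Measurable fun ω => κ ω (Prod.mk ω ⁻¹' B) :=
      (Kernel.measurable_kernel_prodMk_left (κ := κ) hB).mono hH le_rfl
    have hzero := lintegral_eq_zero_iff (μ := P) hmeas
    rw [hint] at hzero
    simpa only [ae_iff, not_not, Filter.EventuallyEq, Pi.zero_apply] using hzero
  · intro C A hC hA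
    simp only [Set.preimage_id, id]
    have hprob : ∀ ω, IsProbabilityMeasure (κ ω) := hκ.isProbabilityMeasure
    have hYA : MeasurableSet (Y ⁻¹' A) := hY hA
    have hm : Measurable fun ω => κ ω A := (κ.measurable_coe hA).mono hH le_rfl
    have h1 : ∫ ω in C, (κ ω).real A ∂P = P.real (C ∩ Y ⁻¹' A) := by
      rw [setIntegral_congr_ae (g := P⟦Y ⁻¹' A | H⟧) (hH _ hC)
        ((hκ.ae_eq_condExp A hA).mono fun ω hω _ => hω),
        setIntegral_condExp hH ((integrable_const (1 : ℝ)).indicator hYA) hC,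
        setIntegral_indicator hYA]
      simp
    have h2 : ∫⁻ ω in C, κ ω A ∂P ≠ ⊤ := by
      refine ((lintegral_mono (g := fun _ => 1) fun ω => prob_le_one).trans_lt ?_).ne
      simp [measure_lt_top]
    rw [← ENNReal.toReal_eq_toReal_iff' h2 (measure_ne_top _ _), ← Measure.real, ← h1]
    simp only [Measure.real]
    rw [integral_toReal hm.aemeasurable (Eventually.of_forall fun ω => measure_lt_top _ _)]

end Disintegration

/-! ### Super-hedging prices -/

section Superhedging

variable {Ω : Type*} {d : ℕ}

theorem IsRegularCondLaw.ae_forall_notMem_iff_kernelSupport {H : MeasurableSpace Ω}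
    [mΩ : MeasurableSpace Ω] {P : Measure Ω} [IsProbabilityMeasure P] (hH : H ≤ mΩ)
    {Y : Ω → EuclideanSpace ℝ (Fin d)} (hY : Measurable Y)
    {κ : Kernel[H] Ω (EuclideanSpace ℝ (Fin d))} (hκ : IsRegularCondLaw H P Y κ)
    {B : Set (Ω × EuclideanSpace ℝ (Fin d))} (hB : MeasurableSet[H.prod inferInstance] B)
    (hopen : ∀ ω, IsOpen (Prod.mk ω ⁻¹' B)) :
    (∀ᵐ ω ∂P, (ω, Y ω) ∉ B) ↔ ∀ᵐ ω ∂P, ∀ z ∈ kernelSupport κ ω, (ω, z) ∉ B := by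
  rw [hκ.ae_forall_notMem_iff hH hY hB]
  refine eventually_congr (Eventually.of_forall fun ω => ?_)
  rw [← not_iff_not, ← Ne, ← pos_iff_ne_zero,
    ← Measure.nonempty_inter_support_iff_of_isOpen (hopen ω)]
  simp only [not_forall, not_not, Set.Nonempty, Set.mem_inter_iff, Set.mem_preimage,
    kernelSupport, exists_prop, and_comm]

theorem IsNormalIntegrand.measurableSet_lt_add_inner {H : MeasurableSpace Ω}
    {g : Ω → EuclideanSpace ℝ (Fin d) → ℝ} (hg : IsNormalIntegrand H g) {x : Ω → ℝ}
    (hx : Measurable x) {θ y : Ω → EuclideanSpace ℝ (Fin d)} (hθ : Measurable θ)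
    (hy : Measurable y) :
    MeasurableSet {p : Ω × EuclideanSpace ℝ (Fin d) |
      x p.1 + inner ℝ (θ p.1) (p.2 - y p.1) < g p.1 p.2} :=
  measurableSet_lt ((hx.comp measurable_fst).add
    ((hθ.comp measurable_fst).inner (measurable_snd.sub (hy.comp measurable_fst))))
    hg.measurable_uncurry

/-- A strategy super-hedges the claim almost surely iff, almost surely, it dominates the payoff at
every point of the conditional support. Lower semicontinuity of the payoff is what makes the set of
violations open. -/
theorem ae_le_add_inner_iff {H : MeasurableSpace Ω}
    [mΩ : MeasurableSpace Ω] {P : Measure Ω} [IsProbabilityMeasure P] (hH : H ≤ mΩ)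
    {y Y : Ω → EuclideanSpace ℝ (Fin d)} (hy : Measurable[H] y) (hY : Measurable Y)
    {κ : Kernel[H] Ω (EuclideanSpace ℝ (Fin d))} (hκ : IsRegularCondLaw H P Y κ)
    {g : Ω → EuclideanSpace ℝ (Fin d) → ℝ} (hg : IsNormalIntegrand H g)
    {x : Ω → ℝ} (hx : Measurable[H] x) {θ : Ω → EuclideanSpace ℝ (Fin d)}
    (hθ : Measurable[H] θ) :
    (∀ᵐ ω ∂P, g ω (Y ω) ≤ x ω + inner ℝ (θ ω) (Y ω - y ω)) ↔
      ∀ᵐ ω ∂P, ∀ z ∈ kernelSupport κ ω, g ω z ≤ x ω + inner ℝ (θ ω) (z - y ω) := by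
  have key := hκ.ae_forall_notMem_iff_kernelSupport hH hY
    (hg.measurableSet_lt_add_inner hx hθ hy) fun ω => by
      have hlsc : LowerSemicontinuous fun z => g ω z + -(x ω + inner ℝ (θ ω) (z - y ω)) :=
        (hg.lowerSemicontinuous ω).add (Continuous.lowerSemicontinuous (by fun_prop))
      convert hlsc.isOpen_preimage 0 using 1
      ext z
      simp only [Set.mem_preimage, Set.mem_ofPred_eq, Set.mem_Ioi, ← sub_eq_add_neg, sub_pos]
  simpa only [Set.mem_ofPred_eq, not_lt] using key

theorem ae_forall_mem_kernelSupport_nonneg {H : MeasurableSpace Ω}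
    [mΩ : MeasurableSpace Ω] {P : Measure Ω} [IsProbabilityMeasure P] (hH : H ≤ mΩ)
    {Y : Ω → EuclideanSpace ℝ (Fin d)} (hY : Measurable Y) (hY0 : ∀ ω i, 0 ≤ Y ω i)
    {κ : Kernel[H] Ω (EuclideanSpace ℝ (Fin d))} (hκ : IsRegularCondLaw H P Y κ) :
    ∀ᵐ ω ∂P, ∀ z ∈ kernelSupport κ ω, ∀ i, 0 ≤ z i := by
  have hopen : IsOpen {z : EuclideanSpace ℝ (Fin d) | ∃ i, z i < 0} := by
    simp only [Set.ofPred_exists]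
    exact isOpen_iUnion fun i => isOpen_lt (by fun_prop) continuous_const
  have key := hκ.ae_forall_notMem_iff_kernelSupport hH hY
    (B := Prod.snd ⁻¹' {z : EuclideanSpace ℝ (Fin d) | ∃ i, z i < 0})
    (@measurable_snd _ _ H _ _ hopen.measurableSet) fun _ => hopen
  simpa only [Set.mem_preimage, Set.mem_ofPred_eq, not_exists, not_lt] using
    key.1 (Eventually.of_forall fun ω => by simpa using hY0 ω)

/-- A measurable index of a finite term of the sequence, equal to `n` wherever the `n`-th term is
finite. -/
theorem exists_measurable_index [MeasurableSpace Ω] {c : ℕ → Ω → EReal}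
    (hc : ∀ k, Measurable (c k)) (n : ℕ) :
    ∃ m : Ω → ℕ, Measurable m ∧
      ∀ ω, (∃ k, c k ω < ⊤) → c (m ω) ω < ⊤ ∧ (c n ω < ⊤ → m ω = n) := by
  classical
  -- the second alternative makes the index total where no term is finite
  let p : Ω → ℕ → Prop := fun ω k =>
    (c k ω < ⊤ ∧ (c n ω < ⊤ → k = n)) ∨ ∀ j, ¬ c j ω < ⊤
  have hp : ∀ ω, ∃ k, p ω k := by
    intro ω
    by_cases hn : c n ω < ⊤
    · exact ⟨n, Or.inl ⟨hn, fun _ => rfl⟩⟩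
    · by_cases hk : ∃ k, c k ω < ⊤
      · obtain ⟨k, hk⟩ := hk
        exact ⟨k, Or.inl ⟨hk, fun h => absurd h hn⟩⟩
      · exact ⟨0, Or.inr (not_exists.1 hk)⟩
  have hlt : ∀ k, Measurable fun ω => c k ω < ⊤ := fun k =>
    measurableSet_setOfPred.1 (measurableSet_lt (hc k) measurable_const)
  refine ⟨fun ω => Nat.find (hp ω), measurable_find hp fun k => ?_, fun ω hω => ?_⟩
  · exact measurableSet_setOfPred.2 (((hlt k).and ((hlt n).imp measurable_const)).or
      (Measurable.forall fun j => (hlt j).not))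
  · rcases Nat.find_spec (hp ω) with h | h
    · exact h
    · obtain ⟨k, hk⟩ := hω
      exact absurd hk (h k)

theorem measurable_apply_nat_index {β : Type*} [MeasurableSpace Ω] [MeasurableSpace β]
    {c : ℕ → Ω → β} (hc : ∀ k, Measurable (c k)) {m : Ω → ℕ} (hm : Measurable m) :
    Measurable fun ω => c (m ω) ω :=
  (measurable_from_prod_countable_left (f := fun p : Ω × ℕ => c p.2 p.1) hc).comp
    (measurable_id.prodMk hm)

/-- A super-hedge that uses the rational slope `q` wherever this slope admits a finite constant, and
another admissible rational slope elsewhere. -/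
theorem exists_superhedge_eq_supDeviation {H : MeasurableSpace Ω}
    {y : Ω → EuclideanSpace ℝ (Fin d)} (hy : Measurable y)
    (κ : Kernel Ω (EuclideanSpace ℝ (Fin d))) [IsMarkovKernel κ]
    {g : Ω → EuclideanSpace ℝ (Fin d) → ℝ} (hg : IsNormalIntegrand H g) (q : Fin d → ℚ) :
    ∃ (x : Ω → ℝ) (θ : Ω → EuclideanSpace ℝ (Fin d)), Measurable x ∧ Measurable θ ∧
      ∀ ω, (∃ q', supDeviation (g ω) (kernelSupport κ ω) (ratVector q') < ⊤) →
        (∀ z ∈ kernelSupport κ ω, g ω z ≤ x ω + inner ℝ (θ ω) (z - y ω)) ∧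
        (supDeviation (g ω) (kernelSupport κ ω) (ratVector q) < ⊤ →
          (x ω : EReal) = supDeviation (g ω) (kernelSupport κ ω) (ratVector q) +
            ((inner ℝ (ratVector q) (y ω) : ℝ) : EReal)) := by
  obtain ⟨e, he⟩ := exists_surjective_nat (Fin d → ℚ)
  obtain ⟨n, rfl⟩ := he q
  have hc : ∀ k, Measurable fun ω =>
      supDeviation (g ω) (kernelSupport κ ω) (ratVector (e k)) := fun k =>
    measurable_supDeviation_support hg κ _
  obtain ⟨m, hm, hmc⟩ := exists_measurable_index hc n
  have hθ : Measurable fun ω => ratVector (e (m ω)) :=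
    (measurable_from_nat (f := fun k => ratVector (e k))).comp hm
  have hx : Measurable fun ω =>
      (supDeviation (g ω) (kernelSupport κ ω) (ratVector (e (m ω)))).toReal :=
    Measurable.ereal_toReal (measurable_apply_nat_index hc hm)
  refine ⟨fun ω => (supDeviation (g ω) (kernelSupport κ ω) (ratVector (e (m ω)))).toReal +
    inner ℝ (ratVector (e (m ω))) (y ω), fun ω => ratVector (e (m ω)),
    hx.add (hθ.inner hy), hθ, fun ω hω => ?_⟩
  have hne : (kernelSupport κ ω).Nonempty :=
    Measure.nonempty_support (IsProbabilityMeasure.ne_zero _)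
  obtain ⟨h1, h2⟩ := hmc ω (by
    obtain ⟨q', hq'⟩ := hω
    obtain ⟨k, rfl⟩ := he q'
    exact ⟨k, hq'⟩)
  refine ⟨fun z hz => ?_, fun hn => ?_⟩
  · have := le_inner_add_toReal_supDeviation hne h1 hz
    rw [inner_sub_right]
    linarith
  · dsimp only
    rw [h2 hn, EReal.coe_add, coe_toReal_supDeviation hne hn]

theorem measurable_iInf_supDeviation_add_inner {H : MeasurableSpace Ω}
    {y : Ω → EuclideanSpace ℝ (Fin d)} (hy : Measurable y)
    (κ : Kernel Ω (EuclideanSpace ℝ (Fin d))) [IsMarkovKernel κ]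
    {g : Ω → EuclideanSpace ℝ (Fin d) → ℝ} (hg : IsNormalIntegrand H g) :
    Measurable fun ω => ⨅ q : Fin d → ℚ,
      (supDeviation (g ω) (kernelSupport κ ω) (ratVector q) +
        ((inner ℝ (ratVector q) (y ω) : ℝ) : EReal)) :=
  Measurable.iInf fun _ => (measurable_supDeviation_support hg κ _).add
    (measurable_coe_real_ereal.comp (measurable_const.inner hy))

/-- When the payoff has affine majorants on the conditional support, the infimum super-hedging cost is
the affine envelope at the current price. -/
theorem superhedgingCost_ae_eq_affineEnvelope {H : MeasurableSpace Ω}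
    [mΩ : MeasurableSpace Ω] {P : Measure Ω} [IsProbabilityMeasure P] (hH : H ≤ mΩ)
    {y Y : Ω → EuclideanSpace ℝ (Fin d)} (hy : Measurable[H] y) (hY : Measurable Y)
    (hY0 : ∀ ω i, 0 ≤ Y ω i)
    {κ : Kernel[H] Ω (EuclideanSpace ℝ (Fin d))} (hκ : IsRegularCondLaw H P Y κ)
    {g : Ω → EuclideanSpace ℝ (Fin d) → ℝ} (hg : IsNormalIntegrand H g)
    (hmaj : ∀ᵐ ω ∂P, ∃ (α : EuclideanSpace ℝ (Fin d)) (β : ℝ),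
      ∀ z ∈ kernelSupport κ ω, g ω z ≤ inner ℝ α z + β) :
    ∀ᵐ ω ∂P, superhedgingCost P hH y Y g ω =
      affineEnvelope (g ω) (kernelSupport κ ω) (y ω) := by
  have hmarkov : @IsMarkovKernel Ω _ H _ κ := @IsMarkovKernel.mk Ω _ H _ κ hκ.isProbabilityMeasure
  have hne : ∀ ω, (kernelSupport κ ω).Nonempty := fun ω => by
    have := hκ.isProbabilityMeasure ω
    exact Measure.nonempty_support (IsProbabilityMeasure.ne_zero _)
  have hpos := ae_forall_mem_kernelSupport_nonneg hH hY hY0 hκ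
  have hinf : IsCondEssInf H P (superhedgingPrices H P y Y g) (superhedgingCost P hH y Y g) :=
    isCondEssInf_condEssInf P hH _
  have hlower : ∀ᵐ ω ∂P, (⨅ q : Fin d → ℚ,
      (supDeviation (g ω) (kernelSupport κ ω) (ratVector q) +
        ((inner ℝ (ratVector q) (y ω) : ℝ) : EReal))) ≤ superhedgingCost P hH y Y g ω := by
    refine hinf.greatest _ (measurable_iInf_supDeviation_add_inner hy κ hg) ?_
    rintro x ⟨hx, θ, hθ, hxθ⟩
    filter_upwards [hpos, (ae_le_add_inner_iff hH hy hY hκ hg hx hθ).1 hxθ] with ω hω h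
    rw [← affineEnvelope_eq_iInf_ratVector (hne ω) hω]
    refine (affineEnvelope_le (α := θ ω) (β := x ω - inner ℝ (θ ω) (y ω))
      (fun z hz => ?_) (y ω)).trans (by simp)
    have := h z hz
    rw [inner_sub_right] at this
    linarith
  have hupper : ∀ᵐ ω ∂P, ∀ q : Fin d → ℚ, superhedgingCost P hH y Y g ω ≤
      supDeviation (g ω) (kernelSupport κ ω) (ratVector q) +
        ((inner ℝ (ratVector q) (y ω) : ℝ) : EReal) := by
    refine ae_all_iff.2 fun q => ?_
    obtain ⟨x, θ, hx, hθ, hxθ⟩ := exists_superhedge_eq_supDeviation hy κ hg q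
    have hfin : ∀ᵐ ω ∂P,
        ∃ q', supDeviation (g ω) (kernelSupport κ ω) (ratVector q') < ⊤ := by
      filter_upwards [hpos, hmaj] with ω hω ⟨α, β, hαβ⟩
      exact exists_ratVector_supDeviation_lt_top hω hαβ
    have hmem : x ∈ superhedgingPrices H P y Y g :=
      ⟨hx, θ, hθ, (ae_le_add_inner_iff hH hy hY hκ hg hx hθ).2
        (hfin.mono fun ω hω => (hxθ ω hω).1)⟩
    filter_upwards [hfin, hinf.le x hmem] with ω hω hle
    rcases eq_or_ne (supDeviation (g ω) (kernelSupport κ ω) (ratVector q)) ⊤ with htop | htop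
    · simp [htop]
    · exact hle.trans_eq ((hxθ ω hω).2 htop.lt_top)
  filter_upwards [hpos, hlower, hupper] with ω hω h1 h2
  rw [affineEnvelope_eq_iInf_ratVector (hne ω) hω]
  exact le_antisymm (le_iInf h2) h1

end Superhedging

theorem proposition2p4 {Ω : Type*} (H F : MeasurableSpace Ω) [mΩ : MeasurableSpace Ω]
    (P : Measure Ω) [IsProbabilityMeasure P] [P.IsComplete]
    (hF : F ≤ mΩ) (hHF : H ≤ F)
    (hFc : (P.trim hF).IsComplete) (hHc : (P.trim (hHF.trans hF)).IsComplete)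
    (d : ℕ) (y Y : Ω → EuclideanSpace ℝ (Fin d))
    (hy : Measurable[H] y) (hY : Measurable[F] Y)
    (hy0 : ∀ ω i, 0 ≤ y ω i) (hY0 : ∀ ω i, 0 ≤ Y ω i)
    (κ : Kernel[H] Ω (EuclideanSpace ℝ (Fin d))) (hκ : IsRegularCondLaw H P Y κ)
    (g : Ω → EuclideanSpace ℝ (Fin d) → ℝ) (hg : IsNormalIntegrand H g)
    (φ : Ω → EuclideanSpace ℝ (Fin d) → EReal)
    (hφ : ∀ᵐ ω ∂P, IsConcaveEReal (φ ω) ∧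
      (∀ z ∈ kernelSupport κ ω, (g ω z : EReal) ≤ φ ω z) ∧
      ∀ z ∈ convexHull ℝ (kernelSupport κ ω), φ ω z < ⊤) :
    (∀ᵐ ω ∂P, superhedgingCost P (hHF.trans hF) y Y g ω =
      uscClosure (relConc (g ω) (kernelSupport κ ω)) (y ω) -
        deltaInd (closedConvexHull ℝ (kernelSupport κ ω)) (y ω)) ∧
    (∀ᵐ ω ∂P, superhedgingCost P (hHF.trans hF) y Y g ω =
      affineEnvelope (g ω) (kernelSupport κ ω) (y ω) -
        deltaInd (closedConvexHull ℝ (kernelSupport κ ω)) (y ω)) := by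
  have hne : ∀ ω, (kernelSupport κ ω).Nonempty := fun ω => by
    have := hκ.isProbabilityMeasure ω
    exact Measure.nonempty_support (IsProbabilityMeasure.ne_zero _)
  have hmaj : ∀ᵐ ω ∂P, ∃ (α : EuclideanSpace ℝ (Fin d)) (β : ℝ),
      ∀ z ∈ kernelSupport κ ω, g ω z ≤ inner ℝ α z + β := by
    filter_upwards [hφ] with ω ⟨hconc, hle, htop⟩
    exact exists_affine_majorant_of_isConcaveEReal hconc (hne ω) hle htop
  have hcost := superhedgingCost_ae_eq_affineEnvelope (hHF.trans hF) hy (hY.mono hF le_rfl) hY0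
    hκ hg hmaj
  constructor
  · filter_upwards [hcost, hmaj] with ω hω ⟨α, β, hαβ⟩
    rw [uscClosure_relConc_eq_affineEnvelope hαβ (hne ω), affineEnvelope_sub_deltaInd hαβ, hω]
  · filter_upwards [hcost, hmaj] with ω hω ⟨α, β, hαβ⟩
    rw [affineEnvelope_sub_deltaInd hαβ, hω]
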